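/- Let $G$ be a locally compact Hausdorff group with modular function $\Delta_G\colon G\to\mathbb{R}_+=(0,\infty)$, normalized by $\mu_G(E\cdot s)=\Delta_G(s)\,\mu_G(E)$ for a left Haar measure $\mu_G$. Assume that $G$ is almost unimodular, that is, $\ker\Delta_G$ is open in $G$. Give $\Delta_G(G)$ the discrete topology, let $\Delta_G(G)\hat{\ }$ be its compact dual group, and let $(\cdot\mid\cdot)\colon\Delta_G(G)\hat{\ }\times\Delta_G(G)\to\mathbb{T}$ be the dual pairing. Fix a normalized section $\sigma\colon\Delta_G(G)\to G$ for $\Delta_G$ (that is, any map with $\Delta_G(\sigma(\delta))=\delta$ for all $\delta$ and $\sigma(1)=e$). A representation means a strongly continuous unitary representation on a complex Hilbert space. For a representation $(\pi_1,\mathcal H_1)$ of $\ker\Delta_G$, the induced representation $\operatorname{Ind}_{\ker\Delta_G}^G(\pi_1,\mathcal H_1)$ of $G$ is realized on $\ell^2(\Delta_G(G))\otimes\mathcal H_1=\ell^2(\Delta_G(G),\mathcal H_1)$ by $$[(\operatorname{Ind}_{\ker\Delta_G}^G\pi_1)(s)f](\delta)=\pi_1\big(\sigma(\delta)^{-1}s\,\sigma(\Delta_G(s)^{-1}\delta)\big)f(\Delta_G(s)^{-1}\delta),\qquad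 s\in G,\ \delta\in\Delta_G(G).$$ **Theorem 3.1.** Let $(\pi,\mathcal H)$ be a representation of $G$. The following are equivalent: 1. $(\pi,\mathcal H)$ is unitarily equivalent to $\operatorname{Ind}_{\ker\Delta_G}^G(\pi_1,\mathcal H_1)$ for some representation $(\pi_1,\mathcal H_1)$ of $\ker\Delta_G$. 2. There exists a representation $U\colon\Delta_G(G)\hat{\ }\to U(\mathcal H)$ satisfying $U_\gamma\,\pi(s)\,U_\gamma^*=(\gamma\mid\Delta_G(s))\,\pi(s)$ for all $\gamma\in\Delta_G(G)\hat{\ }$ and $s\in G$. -/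

import Mathlib

open MeasureTheory Topology
open scoped NNReal ENNReal

noncomputable section

namespace AlmostUnimodular

/-! ### Unitary representations -/

/-- A (strongly continuous) unitary representation of the topological group `G` on the Hilbert
space `H`. -/
structure UnitaryRep (G : Type*) [Group G] [TopologicalSpace G]
    (H : Type*) [NormedAddCommGroup H] [InnerProductSpace ℂ H] [CompleteSpace H] where
  /-- The underlying homomorphism into the unitary group of `H`. -/
  toHom : G →* unitary (H →L[ℂ] H)
  /-- Continuity for the strong operator topology. -/
  continuous_apply : ∀ ξ : H, Continuous fun s : G => (toHom s : H →L[ℂ] H) ξ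

/-- The operator on `H` by which `s` acts, also written `π s`. -/
def UnitaryRep.op {G : Type*} [Group G] [TopologicalSpace G]
    {H : Type*} [NormedAddCommGroup H] [InnerProductSpace ℂ H] [CompleteSpace H]
    (π : UnitaryRep G H) (s : G) : H →L[ℂ] H := π.toHom s

theorem UnitaryRep.op_one {G : Type*} [Group G] [TopologicalSpace G]
    {H : Type*} [NormedAddCommGroup H] [InnerProductSpace ℂ H] [CompleteSpace H]
    (π : UnitaryRep G H) (ξ : H) : π.op 1 ξ = ξ := by simp [UnitaryRep.op]

theorem UnitaryRep.op_mul {G : Type*} [Group G] [TopologicalSpace G]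
    {H : Type*} [NormedAddCommGroup H] [InnerProductSpace ℂ H] [CompleteSpace H]
    (π : UnitaryRep G H) (s t : G) (ξ : H) : π.op (s * t) ξ = π.op s (π.op t ξ) := by
  simp [UnitaryRep.op]

instance {G : Type*} [Group G] [TopologicalSpace G]
    {H : Type*} [NormedAddCommGroup H] [InnerProductSpace ℂ H] [CompleteSpace H] :
    CoeFun (UnitaryRep G H) fun _ => G → H →L[ℂ] H :=
  ⟨UnitaryRep.op⟩

/-- Unitary equivalence of representations: there is a surjective linear isometry intertwining
them. -/
def UnitaryRep.Equivalent {G : Type*} [Group G] [TopologicalSpace G]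
    {H : Type*} [NormedAddCommGroup H] [InnerProductSpace ℂ H] [CompleteSpace H]
    {K : Type*} [NormedAddCommGroup K] [InnerProductSpace ℂ K] [CompleteSpace K]
    (π : UnitaryRep G H) (ρ : UnitaryRep G K) : Prop :=
  ∃ W : H ≃ₗᵢ[ℂ] K, ∀ (s : G) (ξ : H), W (π s ξ) = ρ s (W ξ)

/-! ### The modular function -/

section Modular

variable (G : Type*) [Group G] [TopologicalSpace G] [IsTopologicalGroup G] [LocallyCompactSpace G]

/-- The modular function `Δ_G : G → ℝ₊`, normalized by `μ (E * s) = Δ_G s * μ E` for a left Haar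
measure `μ` (see `measure_mul_right`); the multiplicative group `ℝ₊ = (0, ∞)` is the group of units
of `ℝ≥0`. Mathlib's `modularCharacter` has the opposite normalization, whence the inverse. -/
def modularFunction : G →* ℝ≥0ˣ :=
  (MonoidHom.toHomUnits (Measure.modularCharacter (G := G)))⁻¹

/-- The unimodular part `ker Δ_G` of `G`. -/
abbrev unimodularPart : Subgroup G := (modularFunction G).ker

/-- `G` is almost unimodular if `ker Δ_G` is open in `G`. -/
def IsAlmostUnimodular : Prop := IsOpen (unimodularPart G : Set G)

/-- The image `Δ_G(G)` of the modular function, regarded as a discrete group. -/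
def ModularImage : Type := (modularFunction G).range

instance : CommGroup (ModularImage G) := inferInstanceAs (CommGroup (modularFunction G).range)

instance : TopologicalSpace (ModularImage G) := ⊥

instance : DiscreteTopology (ModularImage G) := ⟨rfl⟩

/-- The modular function as a homomorphism of `G` onto `Δ_G(G)`. -/
def toModularImage : G →* ModularImage G := (modularFunction G).rangeRestrict

variable {G}

/-- The defining property of the modular function: `μ (E * s) = Δ_G s * μ E` for every left Haar
(Radon) measure `μ` and every Borel set `E`. -/
theorem measure_mul_right [MeasurableSpace G] [BorelSpace G] (μ : Measure G)
    [μ.IsHaarMeasure] [μ.Regular] (s : G) (E : Set G) (hE : MeasurableSet E) :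
    μ ((fun t => t * s) '' E) = ((modularFunction G s : ℝ≥0) : ℝ≥0∞) * μ E := by
  have h1 : Measure.map (· * s⁻¹) μ = Measure.modularCharacterFun s⁻¹ • μ := by
    rw [Measure.modularCharacterFun_eq_haarScalarFactor μ]
    have : (Measure.map (· * s⁻¹) μ).Regular :=
      Measure.Regular.map (μ := μ) (Homeomorph.mulRight s⁻¹)
    exact Measure.isMulLeftInvariant_eq_smul_of_regular _ μ
  have h2 : (fun t => t * s) '' E = (fun t => t * s⁻¹) ⁻¹' E := by
    ext x; simp
  have h3 : (modularFunction G s : ℝ≥0) = Measure.modularCharacterFun s⁻¹ := by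
    have : modularFunction G s = MonoidHom.toHomUnits (Measure.modularCharacter (G := G)) s⁻¹ := by
      rw [map_inv]; rfl
    rw [this]; rfl
  rw [h2, ← Measure.map_apply (measurable_mul_const s⁻¹) hE, h1, h3]
  rfl

theorem toModularImage_eq_one_iff (s : G) :
    toModularImage G s = 1 ↔ s ∈ unimodularPart G := by
  rw [MonoidHom.mem_ker]
  exact Subtype.ext_iff

variable (G) in
/-- A normalized section for `Δ_G : G → Δ_G(G)` (no continuity or multiplicativity). -/
structure NormalizedSection where
  /-- The section. -/
  toFun : ModularImage G → G
  map_one : toFun 1 = 1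
  section_apply : ∀ δ, toModularImage G (toFun δ) = δ

instance : CoeFun (NormalizedSection G) fun _ => ModularImage G → G := ⟨NormalizedSection.toFun⟩

/-! ### Representations induced from `ker Δ_G` -/

/-- The element `σ(δ)⁻¹ s σ(Δ_G(s)⁻¹ δ)` of `ker Δ_G`. -/
def NormalizedSection.cocycle (σ : NormalizedSection G) (s : G) (δ : ModularImage G) :
    unimodularPart G :=
  ⟨(σ δ)⁻¹ * s * σ ((toModularImage G s)⁻¹ * δ), by
    rw [← toModularImage_eq_one_iff]
    simp [σ.section_apply]⟩

theorem NormalizedSection.cocycle_one (σ : NormalizedSection G) (δ : ModularImage G) :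
    σ.cocycle 1 δ = 1 := by
  ext; simp [NormalizedSection.cocycle]

theorem NormalizedSection.cocycle_mul (σ : NormalizedSection G) (s t : G) (δ : ModularImage G) :
    σ.cocycle (s * t) δ = σ.cocycle s δ * σ.cocycle t ((toModularImage G s)⁻¹ * δ) := by
  ext; simp [NormalizedSection.cocycle, mul_assoc]

variable {H₁ : Type*} [NormedAddCommGroup H₁] [InnerProductSpace ℂ H₁] [CompleteSpace H₁]

theorem norm_apply (π₁ : UnitaryRep (unimodularPart G) H₁) (k : unimodularPart G) (ξ : H₁) :
    ‖π₁ k ξ‖ = ‖ξ‖ := Unitary.norm_map (π₁.toHom k) ξ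

theorem summable_sq {E : Type*} [NormedAddCommGroup E]
    (f : lp (fun _ : ModularImage G => E) 2) :
    Summable fun δ => ‖f δ‖ ^ 2 := by
  simpa using (lp.memℓp f).summable (by simp)

theorem norm_sq_eq {E : Type*} [NormedAddCommGroup E]
    (f : lp (fun _ : ModularImage G => E) 2) :
    ‖f‖ ^ 2 = ∑' δ, ‖f δ‖ ^ 2 := by
  simpa using lp.norm_rpow_eq_tsum (by simp) f

/-- The linear isometry `f ↦ (δ ↦ π₁(σ(δ)⁻¹ s σ(Δ_G(s)⁻¹ δ)) f(Δ_G(s)⁻¹ δ))` of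
`ℓ²(Δ_G(G), H₁) = ℓ²(Δ_G(G)) ⊗ H₁`. -/
def inducedIsometry (σ : NormalizedSection G) (π₁ : UnitaryRep (unimodularPart G) H₁) (s : G) :
    lp (fun _ : ModularImage G => H₁) 2 →ₗᵢ[ℂ] lp (fun _ : ModularImage G => H₁) 2 where
  toFun f := ⟨fun δ => π₁ (σ.cocycle s δ) (f ((toModularImage G s)⁻¹ * δ)), by
    refine memℓp_gen ?_
    simp only [norm_apply]
    have := (Equiv.mulLeft (toModularImage G s)⁻¹).summable_iff.2 (summable_sq f)
    simpa [Function.comp_def] using this⟩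
  map_add' f g := by ext δ; exact map_add (π₁ (σ.cocycle s δ)) _ _
  map_smul' c f := by ext δ; exact map_smul (π₁ (σ.cocycle s δ)) c _
  norm_map' f := by
    rw [← sq_eq_sq₀ (norm_nonneg _) (norm_nonneg _), norm_sq_eq, norm_sq_eq,
      ← (Equiv.mulLeft (toModularImage G s)⁻¹).tsum_eq fun δ => ‖f δ‖ ^ 2]
    exact tsum_congr fun δ => congrArg (· ^ 2) (norm_apply π₁ (σ.cocycle s δ) _)

theorem inducedIsometry_apply (σ : NormalizedSection G) (π₁ : UnitaryRep (unimodularPart G) H₁)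
    (s : G) (f : lp (fun _ : ModularImage G => H₁) 2) (δ : ModularImage G) :
    inducedIsometry σ π₁ s f δ = π₁ (σ.cocycle s δ) (f ((toModularImage G s)⁻¹ * δ)) := rfl

theorem inducedIsometry_one (σ : NormalizedSection G) (π₁ : UnitaryRep (unimodularPart G) H₁)
    (f : lp (fun _ : ModularImage G => H₁) 2) : inducedIsometry σ π₁ 1 f = f := by
  ext δ
  simp [inducedIsometry_apply, σ.cocycle_one, UnitaryRep.op_one]

theorem inducedIsometry_mul (σ : NormalizedSection G) (π₁ : UnitaryRep (unimodularPart G) H₁)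
    (s t : G) (f : lp (fun _ : ModularImage G => H₁) 2) :
    inducedIsometry σ π₁ (s * t) f = inducedIsometry σ π₁ s (inducedIsometry σ π₁ t f) := by
  ext δ
  simp [inducedIsometry_apply, σ.cocycle_mul, UnitaryRep.op_mul, mul_assoc]

/-- The operators `inducedIsometry σ π₁ s` as a homomorphism into the unitary group. -/
def inducedHom (σ : NormalizedSection G) (π₁ : UnitaryRep (unimodularPart G) H₁) :
    G →* unitary (lp (fun _ : ModularImage G => H₁) 2 →L[ℂ] lp (fun _ : ModularImage G => H₁) 2) :=
  (Unitary.linearIsometryEquiv (𝕜 := ℂ)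
      (H := lp (fun _ : ModularImage G => H₁) 2)).symm.toMonoidHom.comp
    { toFun := fun s =>
        { (inducedIsometry σ π₁ s) with
          invFun := inducedIsometry σ π₁ s⁻¹
          left_inv := fun f =>
            ((inducedIsometry_mul σ π₁ s⁻¹ s f).symm.trans (by rw [inv_mul_cancel])).trans
              (inducedIsometry_one σ π₁ f)
          right_inv := fun f =>
            ((inducedIsometry_mul σ π₁ s s⁻¹ f).symm.trans (by rw [mul_inv_cancel])).trans
              (inducedIsometry_one σ π₁ f) }
      map_one' := LinearIsometryEquiv.ext (inducedIsometry_one σ π₁)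
      map_mul' := fun s t => LinearIsometryEquiv.ext (inducedIsometry_mul σ π₁ s t) }

theorem continuous_inducedIsometry (hG : IsAlmostUnimodular G) (σ : NormalizedSection G)
    (π₁ : UnitaryRep (unimodularPart G) H₁) (f : lp (fun _ : ModularImage G => H₁) 2) :
    Continuous fun s => inducedIsometry σ π₁ s f := by
  have key : ∀ g : lp (fun _ : ModularImage G => H₁) 2,
      Filter.Tendsto (fun k : G => inducedIsometry σ π₁ k g) (𝓝 1) (𝓝 g) := by
    intro g
    have hker : ∀ᶠ k : G in 𝓝 1, toModularImage G k = 1 := by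
      filter_upwards [hG.mem_nhds (unimodularPart G).one_mem] with k hk
      exact (toModularImage_eq_one_iff k).2 hk
    rw [tendsto_iff_norm_sub_tendsto_zero]
    have hsq : Filter.Tendsto (fun k : G => ‖inducedIsometry σ π₁ k g - g‖ ^ 2) (𝓝 1) (𝓝 0) := by
      simp only [norm_sq_eq]
      rw [show (0 : ℝ) = ∑' _ : ModularImage G, (0 : ℝ) by simp]
      refine tendsto_tsum_of_dominated_convergence (bound := fun δ => 4 * ‖g δ‖ ^ 2)
        ((summable_sq g).mul_left 4) ?_ ?_
      · intro δ
        have hmem : ∀ k : G, k ∈ unimodularPart G → (σ δ)⁻¹ * k * σ δ ∈ unimodularPart G := by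
          intro k hk
          simpa using (inferInstance : (unimodularPart G).Normal).conj_mem k hk (σ δ)⁻¹
        have hc : Filter.Tendsto (fun k : unimodularPart G =>
            π₁ ⟨(σ δ)⁻¹ * k * σ δ, hmem k k.2⟩ (g δ)) (𝓝 1) (𝓝 (g δ)) := by
          have h := ((π₁.continuous_apply (g δ)).comp (Continuous.subtype_mk
            (by fun_prop : Continuous fun k : unimodularPart G => (σ δ)⁻¹ * (k : G) * σ δ)
            (fun k => hmem k k.2))).tendsto 1
          have e : (⟨(σ δ)⁻¹ * ((1 : unimodularPart G) : G) * σ δ,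
              hmem _ (1 : unimodularPart G).2⟩ : unimodularPart G) = 1 := by ext; simp
          simp only [Function.comp_def] at h
          rw [e] at h
          rw [show ((π₁.toHom 1 : unitary (H₁ →L[ℂ] H₁)) : H₁ →L[ℂ] H₁) (g δ) = g δ from
            π₁.op_one (g δ)] at h
          exact h
        have hc' : Filter.Tendsto (fun k : G => inducedIsometry σ π₁ k g δ) (𝓝 1) (𝓝 (g δ)) := by
          have hmap : Filter.map ((↑) : unimodularPart G → G) (𝓝 1) = 𝓝 1 :=
            hG.isOpenEmbedding_subtypeVal.map_nhds_eq 1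
          rw [← hmap, Filter.tendsto_map'_iff]
          refine hc.congr fun k => ?_
          have hk : toModularImage G (k : G) = 1 := (toModularImage_eq_one_iff _).2 k.2
          have e1 : (toModularImage G (k : G))⁻¹ * δ = δ := by rw [hk]; simp
          have e2 : σ.cocycle (k : G) δ = ⟨(σ δ)⁻¹ * k * σ δ, hmem k k.2⟩ := by
            ext; simp [NormalizedSection.cocycle, hk]
          rw [Function.comp_apply, inducedIsometry_apply, e1, e2]
        have h0 := ((hc'.sub_const (g δ)).norm).pow 2
        simpa using h0
      · filter_upwards [hker] with k hk δ
        have h1 : ‖inducedIsometry σ π₁ k g δ‖ = ‖g δ‖ := by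
          rw [inducedIsometry_apply, norm_apply, hk]; simp
        have h2 : ‖(inducedIsometry σ π₁ k g - g) δ‖ ≤ 2 * ‖g δ‖ := by
          refine (norm_sub_le (inducedIsometry σ π₁ k g δ) (g δ)).trans ?_
          rw [h1]; linarith
        rw [Real.norm_of_nonneg (by positivity)]
        nlinarith [norm_nonneg ((inducedIsometry σ π₁ k g - g) δ), norm_nonneg (g δ)]
    have := hsq.sqrt
    simpa [Real.sqrt_sq] using this
  rw [continuous_iff_continuousAt]
  intro s
  have h := (key (inducedIsometry σ π₁ s f)).comp
    (show Filter.Tendsto (fun t : G => t * s⁻¹) (𝓝 s) (𝓝 1) from by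
      have : ContinuousAt (fun t : G => t * s⁻¹) s := by fun_prop
      simpa [ContinuousAt] using this)
  refine h.congr fun t => ?_
  rw [Function.comp_apply, ← inducedIsometry_mul, inv_mul_cancel_right]

/-- The induced representation `Ind_{ker Δ_G}^G (π₁, H₁)` of an almost unimodular group, realized
on `ℓ²(Δ_G(G)) ⊗ H₁ = ℓ²(Δ_G(G), H₁)` by means of a normalized section `σ` for `Δ_G`:
`[(Ind π₁)(s) f](δ) = π₁(σ(δ)⁻¹ s σ(Δ_G(s)⁻¹ δ)) f(Δ_G(s)⁻¹ δ)`. -/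
def inducedRep (hG : IsAlmostUnimodular G) (σ : NormalizedSection G)
    (π₁ : UnitaryRep (unimodularPart G) H₁) :
    UnitaryRep G (lp (fun _ : ModularImage G => H₁) 2) where
  toHom := inducedHom σ π₁
  continuous_apply := continuous_inducedIsometry hG σ π₁

theorem inducedRep_apply (hG : IsAlmostUnimodular G) (σ : NormalizedSection G)
    (π₁ : UnitaryRep (unimodularPart G) H₁) (s : G) (f : lp (fun _ : ModularImage G => H₁) 2)
    (δ : ModularImage G) :
    (inducedRep hG σ π₁ s f : ModularImage G → H₁) δ =
      π₁ (σ.cocycle s δ) (f ((toModularImage G s)⁻¹ * δ)) := rfl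

end Modular

end AlmostUnimodular

end

open AlmostUnimodular

universe u v

/-! A representation `U` of the compact dual of the discrete group `Δ_G(G)` is the same thing as a
grading of `H` by `Δ_G(G)`: the degree `δ` part `H_δ` consists of the vectors on which each `U γ` is
multiplication by `γ δ`. These parts are mutually orthogonal
(`inner_eq_zero_of_mem_spectralSubspace`) and total (`iSup_spectralSubspace_closure_eq_top`, by
Fourier analysis on the dual). The covariance relation says exactly that `π s` carries `H_δ` into
the part of degree `Δ_G(s) δ` (`op_mem_spectralSubspace`). Hence `ker Δ_G` acts on `H_1`, and `π (σ
δ)` maps `H_1` onto `H_δ`, so that `H` is a Hilbert sum of copies of `H_1` (`isHilbertSum_section`).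
In these coordinates `π` becomes the induced representation of `H_1`. Conversely, `ℓ²(Δ_G(G), H₁)`
is graded by its coordinates; multiplication by characters is the corresponding `U`, and an induced
operator shifts coordinates by `Δ_G(s)` (`mulCharacterRep_inducedRep`). -/

noncomputable section

namespace AlmostUnimodular

open scoped InnerProductSpace

/-! ### Generalities on unitary representations -/

namespace UnitaryRep

section Basic

variable {K : Type*} [Group K] [TopologicalSpace K]
  {H : Type*} [NormedAddCommGroup H] [InnerProductSpace ℂ H] [CompleteSpace H]

theorem continuous_op (π : UnitaryRep K H) (ξ : H) : Continuous fun s => π s ξ :=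
  π.continuous_apply ξ

theorem norm_op (π : UnitaryRep K H) (s : K) (ξ : H) : ‖π s ξ‖ = ‖ξ‖ :=
  Unitary.norm_map (π.toHom s) ξ

theorem inner_op_op (π : UnitaryRep K H) (s : K) (ξ η : H) : ⟪π s ξ, π s η⟫_ℂ = ⟪ξ, η⟫_ℂ :=
  Unitary.inner_map_map (π.toHom s) ξ η

theorem star_op (π : UnitaryRep K H) (s : K) : star (π s) = π s⁻¹ := by
  rw [op, op, map_inv]
  rfl

theorem op_inv_op (π : UnitaryRep K H) (s : K) (ξ : H) : π s⁻¹ (π s ξ) = ξ := by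
  rw [← op_mul, inv_mul_cancel, op_one]

theorem op_op_inv (π : UnitaryRep K H) (s : K) (ξ : H) : π s (π s⁻¹ ξ) = ξ := by
  rw [← op_mul, mul_inv_cancel, op_one]

/-- The operator by which a group element acts, as a linear isometry. -/
def isometry (π : UnitaryRep K H) (s : K) : H →ₗᵢ[ℂ] H where
  toLinearMap := (π s : H →L[ℂ] H)
  norm_map' := π.norm_op s

@[simp]
theorem isometry_apply (π : UnitaryRep K H) (s : K) (ξ : H) : π.isometry s ξ = π s ξ := rfl

/-- A unitary representation given by a strongly continuous multiplicative family of linear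
isometries. -/
def ofIsometry (A : K → H →ₗᵢ[ℂ] H) (one : ∀ ξ, A 1 ξ = ξ)
    (mul : ∀ s t ξ, A (s * t) ξ = A s (A t ξ)) (cont : ∀ ξ, Continuous fun s => A s ξ) :
    UnitaryRep K H where
  toHom := (Unitary.linearIsometryEquiv (𝕜 := ℂ) (H := H)).symm.toMonoidHom.comp
    { toFun := fun s =>
        { A s with
          invFun := A s⁻¹
          left_inv := fun ξ => ((mul s⁻¹ s ξ).symm.trans (by rw [inv_mul_cancel])).trans (one ξ)
          right_inv := fun ξ => ((mul s s⁻¹ ξ).symm.trans (by rw [mul_inv_cancel])).trans (one ξ) }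
      map_one' := LinearIsometryEquiv.ext one
      map_mul' := fun s t => LinearIsometryEquiv.ext (mul s t) }
  continuous_apply := cont

/-- The restriction of a representation to a subgroup and a closed subspace invariant under it. -/
def restrict (π : UnitaryRep K H) (L : Subgroup K) (E : Submodule ℂ H) [CompleteSpace E]
    (hE : ∀ k ∈ L, ∀ ξ ∈ E, π k ξ ∈ E) : UnitaryRep L E :=
  ofIsometry
    (fun k =>
      { toLinearMap := (π (k : K) : H →L[ℂ] H).toLinearMap.restrict (hE k k.2)
        norm_map' := fun ξ => π.norm_op k ξ })
    (fun ξ => Subtype.ext (π.op_one ξ))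
    (fun s t ξ => Subtype.ext (π.op_mul s t ξ))
    (fun ξ => ((π.continuous_op (ξ : H)).comp continuous_subtype_val).subtype_mk _)

end Basic

end UnitaryRep

/-! ### Representations of the dual of a discrete abelian group -/

section Dual

variable {A : Type*} [CommGroup A] [TopologicalSpace A]

/-- Evaluation at `a` as a complex valued continuous function on the dual group. -/
def evalDual (a : A) : C(PontryaginDual A, ℂ) where
  toFun γ := γ a
  continuous_toFun := by
    have : Continuous fun γ : PontryaginDual A => γ a :=
      ContinuousEvalConst.continuous_eval_const (F := A →ₜ* Circle) a
    exact continuous_induced_dom.comp this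

@[simp]
theorem evalDual_apply (a : A) (γ : PontryaginDual A) : evalDual a γ = γ a := rfl

variable {H : Type*} [NormedAddCommGroup H] [InnerProductSpace ℂ H] [CompleteSpace H]

/-- The spectral subspace of a representation of the dual group corresponding to `a`. -/
def spectralSubspace (U : UnitaryRep (PontryaginDual A) H) (a : A) : Submodule ℂ H :=
  ⨅ γ : PontryaginDual A, LinearMap.ker ((U γ - (γ a : ℂ) • ContinuousLinearMap.id ℂ H).toLinearMap)

theorem mem_spectralSubspace {U : UnitaryRep (PontryaginDual A) H} {a : A} {ξ : H} :
    ξ ∈ spectralSubspace U a ↔ ∀ γ, U γ ξ = (γ a : ℂ) • ξ := by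
  simp [spectralSubspace, sub_eq_zero]

theorem isClosed_spectralSubspace (U : UnitaryRep (PontryaginDual A) H) (a : A) :
    IsClosed (spectralSubspace U a : Set H) := by
  have : (spectralSubspace U a : Set H) = ⋂ γ, {ξ | U γ ξ = (γ a : ℂ) • ξ} := by
    ext ξ; simp [mem_spectralSubspace]
  rw [this]
  exact isClosed_iInter fun γ => isClosed_eq (U γ).continuous (continuous_const_smul _)

instance (U : UnitaryRep (PontryaginDual A) H) (a : A) : CompleteSpace (spectralSubspace U a) :=
  (isClosed_spectralSubspace U a).completeSpace_coe

/-- Unitarity of `U γ` multiplies the inner product by `(γ a)⁻¹ * γ b`, which is not `1`. -/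
theorem inner_eq_zero_of_mem_spectralSubspace {U : UnitaryRep (PontryaginDual A) H} {a b : A}
    {γ : PontryaginDual A} (hγ : γ a ≠ γ b) {ξ η : H} (hξ : ξ ∈ spectralSubspace U a)
    (hη : η ∈ spectralSubspace U b) : ⟪ξ, η⟫_ℂ = 0 := by
  have h := U.inner_op_op γ ξ η
  rw [mem_spectralSubspace.1 hξ, mem_spectralSubspace.1 hη, inner_smul_left, inner_smul_right,
    ← mul_assoc, ← Circle.coe_inv_eq_conj, ← Circle.coe_mul] at h
  by_contra hne
  have h1 : (γ a)⁻¹ * γ b = 1 := Circle.ext (by simpa [hne] using h)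
  exact hγ (inv_mul_eq_one.1 h1)

variable [DiscreteTopology A]

variable (A) in
/-- The star algebra generated by the evaluations on the dual group. -/
def evalDualSubalgebra : StarSubalgebra ℂ C(PontryaginDual A, ℂ) where
  toSubalgebra := Algebra.adjoin ℂ (Set.range evalDual)
  star_mem' := by
    change Algebra.adjoin ℂ (Set.range evalDual) ≤ star (Algebra.adjoin ℂ (Set.range evalDual))
    refine Algebra.adjoin_le ?_
    rintro - ⟨a, rfl⟩
    refine Algebra.subset_adjoin ⟨a⁻¹, ?_⟩
    ext γ
    simp [← Circle.coe_inv_eq_conj]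

-- Evaluations are closed under products and contain `1`, so their linear span is already an
-- algebra. Linear functionals can thus be tested on evaluations alone.
variable (A) in
theorem evalDualSubalgebra_coe :
    Subalgebra.toSubmodule (evalDualSubalgebra A).toSubalgebra =
      Submodule.span ℂ (Set.range evalDual) := by
  apply Algebra.adjoin_eq_span_of_subset
  refine Set.Subset.trans ?_ Submodule.subset_span
  intro x hx
  refine Submonoid.closure_induction (fun _ => id) ⟨1, ?_⟩ ?_ hx
  · ext γ; simp
  · rintro - - - - ⟨a, rfl⟩ ⟨b, rfl⟩
    exact ⟨a * b, by ext γ; simp⟩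

-- Stone–Weierstrass: characters of `A` that agree at every point of `A` are equal, so evaluations
-- separate points of the dual.
variable (A) in
theorem span_evalDual_closure_eq_top :
    (Submodule.span ℂ (Set.range (evalDual (A := A)))).topologicalClosure = ⊤ := by
  rw [← evalDualSubalgebra_coe]
  refine congr_arg (Subalgebra.toSubmodule <| StarSubalgebra.toSubalgebra ·)
    (ContinuousMap.starSubalgebra_topologicalClosure_eq_top_of_separatesPoints
      (evalDualSubalgebra A) ?_)
  intro γ γ' h
  obtain ⟨a, ha⟩ : ∃ a, γ a ≠ γ' a := by
    by_contra! hc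
    exact h (PontryaginDual.ext hc)
  refine ⟨_, ⟨evalDual a, Algebra.subset_adjoin ⟨a, rfl⟩, rfl⟩, ?_⟩
  exact fun h => ha (Circle.ext h)

/-- A continuous function on the dual of a discrete abelian group all of whose Fourier
coefficients vanish is zero. -/
theorem eq_zero_of_integral_evalDual_mul [MeasurableSpace (PontryaginDual A)]
    [BorelSpace (PontryaginDual A)] (μ : Measure (PontryaginDual A)) [μ.IsHaarMeasure]
    (F : C(PontryaginDual A, ℂ)) (h : ∀ a, ∫ γ, evalDual a γ * F γ ∂μ = 0) : F = 0 := by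
  have hint : ∀ f : C(PontryaginDual A, ℂ), Integrable f μ := fun f =>
    f.continuous.integrable_of_hasCompactSupport (HasCompactSupport.of_compactSpace f)
  -- Pairing with `F` is continuous and kills the dense span of the evaluations, hence kills `star
  -- F`; this gives `∫ ‖F‖² = 0`.
  let L : C(PontryaginDual A, ℂ) →ₗ[ℂ] ℂ :=
    { toFun := fun f => ∫ γ, f γ * F γ ∂μ
      map_add' := fun f g => by
        simp only [ContinuousMap.add_apply, add_mul]
        exact integral_add (hint (f * F)) (hint (g * F))
      map_smul' := fun c f => by
        simp only [ContinuousMap.smul_apply, smul_eq_mul, mul_assoc, RingHom.id_apply]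
        exact integral_const_mul c _ }
  have hL : Continuous L := by
    refine AddMonoidHomClass.continuous_of_bound L (‖F‖ * μ.real Set.univ) fun f => ?_
    refine (norm_integral_le_of_norm_le_const (C := ‖f‖ * ‖F‖) (ae_of_all _ fun γ => ?_)).trans
      (le_of_eq (by ring))
    rw [norm_mul]
    exact mul_le_mul (f.norm_coe_le_norm γ) (F.norm_coe_le_norm γ) (norm_nonneg _) (norm_nonneg _)
  have hker : Submodule.span ℂ (Set.range (evalDual (A := A))) ≤ LinearMap.ker L := by
    rw [Submodule.span_le]
    rintro - ⟨a, rfl⟩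
    exact h a
  have htop : LinearMap.ker L = ⊤ := by
    rw [eq_top_iff, ← span_evalDual_closure_eq_top A]
    exact Submodule.topologicalClosure_minimal _ hker (isClosed_singleton.preimage hL)
  have h0 : ∫ γ, star (F γ) * F γ ∂μ = 0 := by
    have : star F ∈ LinearMap.ker L := htop ▸ Submodule.mem_top
    exact this
  have h1 : ∫ γ, ‖F γ‖ ^ 2 ∂μ = 0 := by
    have e : ∀ γ, star (F γ) * F γ = ((‖F γ‖ ^ 2 : ℝ) : ℂ) := fun γ => by
      simpa using Complex.conj_mul' (F γ)
    simp only [e, integral_complex_ofReal] at h0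
    exact_mod_cast h0
  have hc : Continuous fun γ => ‖F γ‖ ^ 2 := by fun_prop
  rw [integral_eq_zero_iff_of_nonneg (fun γ => by positivity)
    (hc.integrable_of_hasCompactSupport (HasCompactSupport.of_compactSpace _))] at h1
  -- Haar measure charges every nonempty open set, so a continuous function vanishing almost
  -- everywhere vanishes.
  have h2 := Measure.eq_of_ae_eq h1 hc continuous_const
  ext γ
  simpa using congrFun h2 γ

/-- The substitution `γ ↦ β * γ` leaves the Haar integral unchanged and pulls out the scalar `β a`.
The integral is, up to normalization, the projection of `ξ` to degree `a`. -/
theorem integral_smul_mem_spectralSubspace [MeasurableSpace (PontryaginDual A)]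
    [BorelSpace (PontryaginDual A)] (μ : Measure (PontryaginDual A)) [μ.IsHaarMeasure]
    (U : UnitaryRep (PontryaginDual A) H) (a : A) (ξ : H) :
    ∫ γ, evalDual a⁻¹ γ • U γ ξ ∂μ ∈ spectralSubspace U a := by
  have hc : Continuous fun γ => evalDual a⁻¹ γ • U γ ξ :=
    (evalDual a⁻¹).continuous.smul (U.continuous_op ξ)
  rw [mem_spectralSubspace]
  intro β
  rw [← ContinuousLinearMap.integral_comp_comm _
    (hc.integrable_of_hasCompactSupport (HasCompactSupport.of_compactSpace _)),
    ← integral_mul_left_eq_self (fun γ => evalDual a⁻¹ γ • U γ ξ) β, ← integral_smul]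
  refine integral_congr_ae (ae_of_all _ fun γ => ?_)
  have h : (β a : ℂ) * evalDual a⁻¹ (β * γ) = evalDual a⁻¹ γ := by
    have e : evalDual a⁻¹ (β * γ) = evalDual a⁻¹ β * evalDual a⁻¹ γ := by
      simp only [evalDual_apply, ← Circle.coe_mul]
      rfl
    rw [e, ← mul_assoc]
    simp
  dsimp only
  rw [map_smul, ← U.op_mul, smul_smul, h]

/-- The spectral subspaces of a representation of the dual of a discrete abelian group are
total. -/
theorem iSup_spectralSubspace_closure_eq_top (U : UnitaryRep (PontryaginDual A) H) :
    (⨆ a, spectralSubspace U a).topologicalClosure = ⊤ := by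
  borelize (PontryaginDual A)
  let μ : Measure (PontryaginDual A) := Measure.haar
  rw [Submodule.topologicalClosure_eq_top_iff, Submodule.eq_bot_iff]
  intro η hη
  -- The Fourier coefficients of this matrix coefficient are inner products of `η` with vectors in
  -- spectral subspaces, so they vanish; yet its value at `1` is `‖η‖²`.
  let F : C(PontryaginDual A, ℂ) :=
    ⟨fun γ => ⟪η, U γ η⟫_ℂ, continuous_const.inner (U.continuous_op η)⟩
  have hF : F = 0 := by
    refine eq_zero_of_integral_evalDual_mul μ F fun a => ?_
    have hc : Continuous fun γ => evalDual a γ • U γ η :=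
      (evalDual a).continuous.smul (U.continuous_op η)
    have hm := integral_smul_mem_spectralSubspace μ U a⁻¹ η
    rw [inv_inv] at hm
    have h := Submodule.inner_left_of_mem_orthogonal
      (Submodule.mem_iSup_of_mem (p := spectralSubspace U) a⁻¹ hm) hη
    rw [← integral_inner
      (hc.integrable_of_hasCompactSupport (HasCompactSupport.of_compactSpace _))] at h
    simpa [F, inner_smul_right] using h
  have h1 := congrArg (· 1) hF
  simpa [F, UnitaryRep.op_one] using h1

end Dual

/-! ### The dual action on vector valued square summable functions -/

section Multiplication

variable {G : Type*} [Group G] [TopologicalSpace G] [IsTopologicalGroup G] [LocallyCompactSpace G]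
  {H₁ : Type*} [NormedAddCommGroup H₁] [InnerProductSpace ℂ H₁] [CompleteSpace H₁]

omit [CompleteSpace H₁] in
theorem norm_circle_smul (z : Circle) (ξ : H₁) : ‖(z : ℂ) • ξ‖ = ‖ξ‖ := by
  rw [norm_smul, Circle.norm_coe, one_mul]

/-- Multiplication by a character, as a linear isometry of `ℓ²(Δ_G(G), H₁)`. -/
def mulCharacter (γ : PontryaginDual (ModularImage G)) :
    lp (fun _ : ModularImage G => H₁) 2 →ₗᵢ[ℂ] lp (fun _ : ModularImage G => H₁) 2 where
  toFun f := ⟨fun δ => (γ δ : ℂ) • f δ, by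
    refine memℓp_gen ?_
    simpa only [norm_circle_smul, ENNReal.toReal_ofNat, Real.rpow_ofNat] using summable_sq f⟩
  map_add' f g := by ext δ; exact smul_add (γ δ : ℂ) (f δ) (g δ)
  map_smul' c f := by ext δ; exact smul_comm (γ δ : ℂ) c (f δ)
  norm_map' f := by
    rw [← sq_eq_sq₀ (norm_nonneg _) (norm_nonneg _), norm_sq_eq, norm_sq_eq]
    refine tsum_congr fun δ => congrArg (· ^ 2) (norm_circle_smul (γ δ) (f δ))

omit [CompleteSpace H₁] in
theorem mulCharacter_apply (γ : PontryaginDual (ModularImage G))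
    (f : lp (fun _ : ModularImage G => H₁) 2) (δ : ModularImage G) :
    mulCharacter γ f δ = (γ δ : ℂ) • f δ := rfl

omit [CompleteSpace H₁] in
theorem continuous_mulCharacter (f : lp (fun _ : ModularImage G => H₁) 2) :
    Continuous fun γ => mulCharacter γ f := by
  rw [continuous_iff_continuousAt]
  intro γ
  rw [ContinuousAt, tendsto_iff_norm_sub_tendsto_zero]
  have hsq : Filter.Tendsto (fun β => ‖mulCharacter β f - mulCharacter γ f‖ ^ 2) (𝓝 γ) (𝓝 0) := by
    simp only [norm_sq_eq]
    rw [show (0 : ℝ) = ∑' _ : ModularImage G, (0 : ℝ) by simp]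
    refine tendsto_tsum_of_dominated_convergence (bound := fun δ => (2 * ‖f δ‖) ^ 2) ?_ ?_ ?_
    · simpa only [mul_pow] using (summable_sq f).mul_left (2 ^ 2)
    · intro δ
      have hc : Continuous fun β => ‖evalDual δ β • f δ - evalDual δ γ • f δ‖ ^ 2 := by fun_prop
      simpa [mulCharacter_apply] using hc.tendsto γ
    · refine Filter.Eventually.of_forall fun β δ => ?_
      rw [Real.norm_of_nonneg (by positivity)]
      have h : ‖(mulCharacter β f - mulCharacter γ f) δ‖ ≤ 2 * ‖f δ‖ := by
        refine (norm_sub_le (mulCharacter β f δ) (mulCharacter γ f δ)).trans ?_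
        rw [mulCharacter_apply, mulCharacter_apply, norm_circle_smul, norm_circle_smul, two_mul]
      gcongr
  simpa [Real.sqrt_sq] using hsq.sqrt

variable (G H₁) in
/-- The representation of the dual of `Δ_G(G)` on `ℓ²(Δ_G(G), H₁)` by multiplication. -/
def mulCharacterRep : UnitaryRep (PontryaginDual (ModularImage G))
    (lp (fun _ : ModularImage G => H₁) 2) :=
  UnitaryRep.ofIsometry mulCharacter
    (fun f => by ext δ; exact one_smul ℂ (f δ))
    (fun β γ f => by ext δ; exact mul_smul (β δ : ℂ) (γ δ : ℂ) (f δ))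
    continuous_mulCharacter

theorem mulCharacterRep_apply (γ : PontryaginDual (ModularImage G))
    (f : lp (fun _ : ModularImage G => H₁) 2) (δ : ModularImage G) :
    (mulCharacterRep G H₁ γ f : ModularImage G → H₁) δ = (γ δ : ℂ) • f δ := rfl

/-- The scalar comes from `γ δ = γ (Δ_G(s)) * γ (Δ_G(s)⁻¹ δ)`; the operators of `π₁` act within each
coordinate and commute with scalars. -/
theorem mulCharacterRep_inducedRep (hG : IsAlmostUnimodular G) (σ : NormalizedSection G)
    (π₁ : UnitaryRep (unimodularPart G) H₁) (γ : PontryaginDual (ModularImage G)) (s : G)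
    (f : lp (fun _ : ModularImage G => H₁) 2) :
    mulCharacterRep G H₁ γ (inducedRep hG σ π₁ s f) =
      (γ (toModularImage G s) : ℂ) • inducedRep hG σ π₁ s (mulCharacterRep G H₁ γ f) := by
  ext δ
  rw [mulCharacterRep_apply, lp.coeFn_smul, Pi.smul_apply, inducedRep_apply, inducedRep_apply,
    mulCharacterRep_apply, map_smul, smul_smul, ← Circle.coe_mul, ← map_mul, mul_inv_cancel_left]

end Multiplication

/-! ### Conjugation by unitaries and the covariance relation -/

/-- Transport of a representation along a unitary. -/
def UnitaryRep.conj {K : Type*} [Group K] [TopologicalSpace K]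
    {H : Type*} [NormedAddCommGroup H] [InnerProductSpace ℂ H] [CompleteSpace H]
    {H' : Type*} [NormedAddCommGroup H'] [InnerProductSpace ℂ H'] [CompleteSpace H']
    (ρ : UnitaryRep K H') (W : H ≃ₗᵢ[ℂ] H') : UnitaryRep K H :=
  UnitaryRep.ofIsometry
    (fun s => W.symm.toLinearIsometry.comp ((ρ.isometry s).comp W.toLinearIsometry))
    (fun ξ => by simp [UnitaryRep.op_one])
    (fun s t ξ => by simp [UnitaryRep.op_mul])
    (fun ξ => W.symm.continuous.comp (ρ.continuous_op (W ξ)))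

theorem UnitaryRep.conj_apply {K : Type*} [Group K] [TopologicalSpace K]
    {H : Type*} [NormedAddCommGroup H] [InnerProductSpace ℂ H] [CompleteSpace H]
    {H' : Type*} [NormedAddCommGroup H'] [InnerProductSpace ℂ H'] [CompleteSpace H']
    (ρ : UnitaryRep K H') (W : H ≃ₗᵢ[ℂ] H') (s : K) (ξ : H) :
    ρ.conj W s ξ = W.symm (ρ s (W ξ)) := rfl

/-- The relation `U π U* = c π` amounts to `U π = c π U`. -/
theorem UnitaryRep.op_mul_mul_star_eq_iff {K : Type*} [Group K] [TopologicalSpace K]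
    {H : Type*} [NormedAddCommGroup H] [InnerProductSpace ℂ H] [CompleteSpace H]
    (U : UnitaryRep K H) (γ : K) (T : H →L[ℂ] H) (c : ℂ) :
    U γ * T * star (U γ) = c • T ↔ ∀ ξ, U γ (T ξ) = c • T (U γ ξ) := by
  rw [U.star_op]
  constructor
  · intro h ξ
    have := congrArg (fun S : H →L[ℂ] H => S (U γ ξ)) h
    simpa [U.op_inv_op] using this
  · intro h
    ext ξ
    simp [h, U.op_op_inv]

/-! ### Spectral subspaces and the modular function -/

section Imprimitivity

variable {G : Type*} [Group G] [TopologicalSpace G] [IsTopologicalGroup G] [LocallyCompactSpace G]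

/-- The characters `δ ↦ δ ^ (i t)` separate the points of `Δ_G(G)`. -/
theorem exists_dual_apply_ne {a b : ModularImage G} (h : a ≠ b) :
    ∃ γ : PontryaginDual (ModularImage G), γ a ≠ γ b := by
  let v : ModularImage G →* ℝ≥0ˣ := (modularFunction G).range.subtype
  have hv : Function.Injective v := Subtype.val_injective
  have hpos : ∀ x, 0 < ((v x : ℝ≥0) : ℝ) := fun x => (v x).ne_zero.bot_lt
  let l : ModularImage G → ℝ := fun x => Real.log ((v x : ℝ≥0) : ℝ)
  have hl : l a ≠ l b := fun e =>
    h (hv (Units.ext (NNReal.eq (Real.log_injOn_pos (hpos a) (hpos b) e))))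
  have hmul : ∀ x y, l (x * y) = l x + l y := fun x y => by
    simp [l, Real.log_mul (hpos x).ne' (hpos y).ne']
  have hone : l 1 = 0 := by simp [l]
  -- With this `t` the two phases differ by `π`, so the values at `a` and `b` are opposite.
  let t : ℝ := Real.pi / (l a - l b)
  let γ : ModularImage G →ₜ* Circle :=
    { toFun := fun x => Circle.exp (t * l x)
      map_one' := by simp [hone]
      map_mul' := fun x y => by rw [hmul, mul_add, Circle.exp_add]
      continuous_toFun := continuous_of_discreteTopology }
  refine ⟨γ, fun e => ?_⟩
  have e1 : Circle.exp (t * l a) = Circle.exp (t * l b) := e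
  have e2 : t * l a = Real.pi + t * l b := by
    have := sub_ne_zero.2 hl
    simp only [t]
    field_simp
    ring
  rw [e2, Circle.exp_add, mul_eq_right] at e1
  have e3 := congrArg (fun z : Circle => (z : ℂ)) e1
  norm_num at e3

variable {H : Type*} [NormedAddCommGroup H] [InnerProductSpace ℂ H] [CompleteSpace H]
  {π : UnitaryRep G H} {U : UnitaryRep (PontryaginDual (ModularImage G)) H}

theorem op_mem_spectralSubspace
    (hU : ∀ γ s ξ, U γ (π s ξ) = (γ (toModularImage G s) : ℂ) • π s (U γ ξ)) (s : G)
    {δ : ModularImage G} {ξ : H} (hξ : ξ ∈ spectralSubspace U δ) :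
    π s ξ ∈ spectralSubspace U (toModularImage G s * δ) := by
  rw [mem_spectralSubspace] at hξ ⊢
  intro γ
  rw [hU, hξ, map_smul, smul_smul, map_mul, Circle.coe_mul]

/-- Covariance decomposes the space as a Hilbert sum of the translates of the fixed vectors. -/
theorem isHilbertSum_section (σ : NormalizedSection G)
    (hU : ∀ γ s ξ, U γ (π s ξ) = (γ (toModularImage G s) : ℂ) • π s (U γ ξ)) :
    IsHilbertSum ℂ (fun _ : ModularImage G => spectralSubspace U 1)
      fun δ => (π.isometry (σ δ)).comp (spectralSubspace U 1).subtypeₗᵢ := by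
  have hmem : ∀ δ (ξ : spectralSubspace U 1), π (σ δ) (ξ : H) ∈ spectralSubspace U δ := by
    intro δ ξ
    simpa [σ.section_apply] using op_mem_spectralSubspace hU (σ δ) ξ.2
  refine IsHilbertSum.mk ?_ ?_
  · intro a b hab ξ η
    obtain ⟨γ, hγ⟩ := exists_dual_apply_ne hab
    exact inner_eq_zero_of_mem_spectralSubspace hγ (hmem a ξ) (hmem b η)
  · rw [← iSup_spectralSubspace_closure_eq_top U]
    refine Submodule.topologicalClosure_mono (iSup_mono fun δ ξ hξ => ?_)
    -- Translating back by `σ δ` lands in degree `1`, so each spectral subspace lies in the range of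
    -- its summand.
    have h := op_mem_spectralSubspace hU (σ δ)⁻¹ hξ
    rw [map_inv, σ.section_apply, inv_mul_cancel] at h
    exact ⟨⟨_, h⟩, π.op_op_inv (σ δ) ξ⟩

/-- The representation of `ker Δ_G` on the fixed vectors of a covariant representation of the dual
of `Δ_G(G)`. -/
def fixedRep (hU : ∀ γ s ξ, U γ (π s ξ) = (γ (toModularImage G s) : ℂ) • π s (U γ ξ)) :
    UnitaryRep (unimodularPart G) (spectralSubspace U 1) :=
  π.restrict (unimodularPart G) (spectralSubspace U 1) fun k hk ξ hξ => by
    simpa [(toModularImage_eq_one_iff k).2 hk] using op_mem_spectralSubspace hU k hξ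

/-- A representation admitting a covariant representation of the dual of `Δ_G(G)` is induced from
`ker Δ_G`. -/
theorem equivalent_inducedRep_fixedRep (hG : IsAlmostUnimodular G) (σ : NormalizedSection G)
    (hU : ∀ γ s ξ, U γ (π s ξ) = (γ (toModularImage G s) : ℂ) • π s (U γ ξ)) :
    π.Equivalent (inducedRep hG σ (fixedRep hU)) := by
  have hsum := isHilbertSum_section σ hU
  refine ⟨hsum.linearIsometryEquiv, fun s ξ => ?_⟩
  obtain ⟨f, rfl⟩ := hsum.linearIsometryEquiv.symm.surjective ξ
  rw [LinearIsometryEquiv.apply_symm_apply, ← LinearIsometryEquiv.eq_symm_apply]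
  -- The inverse unitary sends `f` to `∑ δ, π (σ δ) (f δ)`. After the shift of index below, the two
  -- expansions agree term by term, because `σ δ * σ.cocycle s δ = s * σ (Δ_G(s)⁻¹ δ)`.
  have h1 := (π s).hasSum (hsum.hasSum_linearIsometryEquiv_symm f)
  rw [← (Equiv.mulLeft (toModularImage G s)⁻¹).hasSum_iff] at h1
  refine h1.unique ?_
  convert! hsum.hasSum_linearIsometryEquiv_symm (inducedRep hG σ (fixedRep hU) s f) using 1
  funext δ
  change π s (π (σ ((toModularImage G s)⁻¹ * δ)) (f ((toModularImage G s)⁻¹ * δ) : H)) =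
    π (σ δ) (π (σ.cocycle s δ : G) (f ((toModularImage G s)⁻¹ * δ) : H))
  rw [← π.op_mul, ← π.op_mul]
  simp [NormalizedSection.cocycle, mul_assoc]

end Imprimitivity

end AlmostUnimodular

end

theorem theorem3p1 {G : Type u} [Group G] [TopologicalSpace G] [IsTopologicalGroup G]
    [LocallyCompactSpace G] [T2Space G] (hG : IsAlmostUnimodular G)
    (σ : NormalizedSection G)
    {H : Type v} [NormedAddCommGroup H] [InnerProductSpace ℂ H] [CompleteSpace H]
    (π : UnitaryRep G H) :
    (∃ (H₁ : Type v) (_ : NormedAddCommGroup H₁) (_ : InnerProductSpace ℂ H₁)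
        (_ : CompleteSpace H₁) (π₁ : UnitaryRep (unimodularPart G) H₁),
        π.Equivalent (inducedRep hG σ π₁)) ↔
      ∃ U : UnitaryRep (PontryaginDual (ModularImage G)) H,
        ∀ (γ : PontryaginDual (ModularImage G)) (s : G),
          U γ * π s * star (U γ) = (γ (toModularImage G s) : ℂ) • π s := by

  constructor
  · rintro ⟨H₁, _, _, _, π₁, W, hW⟩
    refine ⟨(mulCharacterRep G H₁).conj W, fun γ s => ?_⟩
    rw [UnitaryRep.op_mul_mul_star_eq_iff]
    intro ξ
    apply W.injective
    rw [map_smul, hW, UnitaryRep.conj_apply, UnitaryRep.conj_apply, W.apply_symm_apply,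
      W.apply_symm_apply, hW, mulCharacterRep_inducedRep]
  · rintro ⟨U, hU⟩
    have hU' : ∀ γ s ξ, U γ (π s ξ) = (γ (toModularImage G s) : ℂ) • π s (U γ ξ) :=
      fun γ s => (U.op_mul_mul_star_eq_iff γ (π s) _).1 (hU γ s)
    -- The inducing space is the space of `U`-fixed vectors.
    exact ⟨spectralSubspace U 1, inferInstance, inferInstance, inferInstance, fixedRep hU',
      equivalent_inducedRep_fixedRep hG σ hU'⟩
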